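/- Let $N\ge 1$ be an integer, $l>0$, $s\in(0,1)$ and $b\in(0,\sqrt l)$. Then there exist a constant $a\in(0,b)$ and a constant $C_a>0$, both depending only on $l,b,N,s$, such that the following holds for every nonempty closed convex set $D\subset\mathbb{R}^N$. Suppose that $u$ is a positive solution of $$\begin{cases}-\Delta u+lu\le u\log u^2 & \text{in } \mathbb{R}^N\setminus D,\\ u\le s & \text{on } \mathbb{R}^N\setminus D.\end{cases}$$ Then $$u(x)\le C_a\,e^{-a\,(\mathrm{dist}(x,D))^2}\qquad\text{for } x\in\mathbb{R}^N\setminus D .$$ Here $\mathrm{dist}$ is the Euclidean distance, and this is asserted, with the same constants, for both notions of solution: 1. classical solutions: $u\in C^2(\mathbb{R}^N\setminus D)$, and $u>0$, $u\le s$ and the differential inequality hold at every point of $\mathbb{R}^N\setminus D$; then the estimate holds for every $x\in\mathbb{R}^N\setminus D$; 2. weak solutions: $u$ is measurable on $\mathbb{R}^N\setminus D$, $0<u\le s$ almost everywhere there, and the inequality holds in the sense of distributions, that is, $\int_{\mathbb{R}^N\setminus D}(-u\,\Delta\varphi+l\,u\varphi)\,dx\le\int_{\mathbb{R}^N\setminus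 D}u\log(u^2)\,\varphi\,dx$ for all $0\le\varphi\in C_c^\infty(\mathbb{R}^N\setminus D)$ (in particular all weak solutions in $H^1_{\mathrm{loc}}(\mathbb{R}^N\setminus D)$); then the estimate holds for almost every $x\in\mathbb{R}^N\setminus D$. -/

import Mathlib

open MeasureTheory
open scoped Laplacian ContDiff

/-- `u` is a positive classical (that is, `C²`) solution of
`-Δu + l u ≤ u log u²`, `u ≤ s` in `ℝᴺ \ D`, for a closed set `D`. -/
structure IsClassicalLogSubsolution {N : ℕ} (D : Set (EuclideanSpace ℝ (Fin N))) (l s : ℝ)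
    (u : EuclideanSpace ℝ (Fin N) → ℝ) : Prop where
  contDiffOn : ContDiffOn ℝ 2 u Dᶜ
  pos : ∀ x ∈ Dᶜ, 0 < u x
  le : ∀ x ∈ Dᶜ, u x ≤ s
  ineq : ∀ x ∈ Dᶜ, -(Δ u x) + l * u x ≤ u x * Real.log (u x ^ 2)

/-- `u` is a positive solution of `-Δu + l u ≤ u log u²`, `u ≤ s` in `ℝᴺ \ D` in the sense of
distributions, for a closed set `D`: the differential inequality is tested against all nonnegative
`φ ∈ C_c^∞(ℝᴺ \ D)`. Since `0 < u ≤ s` almost everywhere on `ℝᴺ \ D`, all the integrands are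
integrable. Weak solutions in `H¹_loc(ℝᴺ \ D)` are included, as `∫ ∇u · ∇φ = -∫ u Δφ` for them. -/
structure IsWeakLogSubsolution {N : ℕ} (D : Set (EuclideanSpace ℝ (Fin N))) (l s : ℝ)
    (u : EuclideanSpace ℝ (Fin N) → ℝ) : Prop where
  aestronglyMeasurable : AEStronglyMeasurable u (volume.restrict Dᶜ)
  pos : ∀ᵐ x, x ∈ Dᶜ → 0 < u x
  le : ∀ᵐ x, x ∈ Dᶜ → u x ≤ s
  ineq : ∀ φ : EuclideanSpace ℝ (Fin N) → ℝ, ContDiff ℝ ∞ φ → HasCompactSupport φ →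
    tsupport φ ⊆ Dᶜ → (∀ x, 0 ≤ φ x) →
    ∫ x in Dᶜ, (-(u x * Δ φ x) + l * u x * φ x) ≤
      ∫ x in Dᶜ, u x * Real.log (u x ^ 2) * φ x

/-! Induction on unit layers shows `u ≤ exp (-a n²)` where the distance to `D` exceeds `n`. If this
holds for `n`, then on the unit ball around a point at distance more than `n + 1` it gives `log u² ≤
-2an²`, so `Δu ≥ κu` with `κ = l + 2an²`. Comparison with a sum of `cosh`
(`le_mul_of_mul_le_laplacian`) gains at the centre a factor of order `exp (-c√κ/N)`. As `√κ` grows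
linearly in `n`, at a rate of order `√a`, for small `a` this beats the required `exp (-a(2n+1))`
(`exists_rate`).

For weak solutions the bound on the logarithm makes the inequality linear, hence stable under
mollification; the classical comparison applies to the mollified functions, which converge almost
everywhere. -/

/-! ### Maximum principle and the `cosh` barrier -/

/-- A positive second derivative would make `x` a local minimum too, so `f` would be locally
constant. -/
theorem IsLocalMax.deriv_deriv_nonpos {f : ℝ → ℝ} {x : ℝ} (h : IsLocalMax f x)
    (hc : ContinuousAt f x) : deriv (deriv f) x ≤ 0 := by
  by_contra! hpos
  have hmin := isLocalMin_of_deriv_deriv_pos hpos h.deriv_eq_zero hc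
  have hconst : f =ᶠ[nhds x] fun _ => f x := by
    filter_upwards [h, hmin] with y h₁ h₂ using le_antisymm h₁ h₂
  have : deriv (deriv f) x = 0 := by
    rw [hconst.deriv.deriv_eq]
    simp
  linarith

theorem deriv_deriv_comp_line {E : Type*} [NormedAddCommGroup E] [NormedSpace ℝ E] {v : E → ℝ}
    {y e : E} (hv : ContDiffAt ℝ 2 v y) :
    (∀ᶠ t in nhds (0 : ℝ), DifferentiableAt ℝ (fun t : ℝ => v (y + t • e)) t) ∧
    HasDerivAt (deriv fun t : ℝ => v (y + t • e)) (iteratedFDeriv ℝ 2 v y ![e, e]) 0 := by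
  have hline : ∀ t : ℝ, HasDerivAt (fun t : ℝ => y + t • e) e t := fun t => by
    simpa using ((hasDerivAt_id t).smul_const e).const_add y
  have hcont : Filter.Tendsto (fun t : ℝ => y + t • e) (nhds 0) (nhds y) := by
    simpa using (hline 0).continuousAt.tendsto
  have hev : ∀ᶠ t in nhds (0 : ℝ), DifferentiableAt ℝ v (y + t • e) := by
    refine hcont.eventually ?_
    filter_upwards [hv.eventually (by simp)] with z hz using hz.differentiableAt (by norm_num)
  have hd : ∀ᶠ t in nhds (0 : ℝ),
      HasDerivAt (fun t : ℝ => v (y + t • e)) (fderiv ℝ v (y + t • e) e) t := by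
    filter_upwards [hev] with t ht
    exact ht.hasFDerivAt.comp_hasDerivAt t (hline t)
  refine ⟨hd.mono fun t ht => ht.differentiableAt, ?_⟩
  have heq : (deriv fun t : ℝ => v (y + t • e)) =ᶠ[nhds 0] fun t => fderiv ℝ v (y + t • e) e :=
    hd.mono fun t ht => ht.deriv
  refine HasDerivAt.congr_of_eventuallyEq ?_ heq
  have h2 : HasFDerivAt (fderiv ℝ v) (fderiv ℝ (fderiv ℝ v) y) y :=
    ((hv.fderiv_right (m := 1) (by norm_num)).differentiableAt one_ne_zero).hasFDerivAt
  have h3 : HasDerivAt (fun t : ℝ => fderiv ℝ v (y + t • e)) (fderiv ℝ (fderiv ℝ v) y e) 0 :=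
    h2.comp_hasDerivAt_of_eq 0 (hline 0) (by simp)
  rw [iteratedFDeriv_two_apply]
  exact (ContinuousLinearMap.apply ℝ ℝ e).hasFDerivAt.comp_hasDerivAt 0 h3

theorem exists_abs_coord_ge {N : ℕ} {z : EuclideanSpace ℝ (Fin N)} (hz : ‖z‖ = 1) :
    ∃ i, 1 / (N : ℝ) ≤ |z i| := by
  by_contra! h
  have hsum : ∑ i, (z i) ^ 2 = 1 := by
    rw [← EuclideanSpace.real_norm_sq_eq, hz, one_pow]
  have hN : 0 < N := by
    rcases Nat.eq_zero_or_pos N with rfl | hN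
    · simp at hsum
    · exact hN
  have : Nonempty (Fin N) := ⟨⟨0, hN⟩⟩
  have hlt : ∑ i : Fin N, (z i) ^ 2 < ∑ _i : Fin N, (1 / (N : ℝ)) ^ 2 := by
    refine Finset.sum_lt_sum_of_nonempty Finset.univ_nonempty fun i _ => ?_
    rw [← sq_abs]
    exact pow_lt_pow_left₀ (h i) (abs_nonneg _) two_ne_zero
  have hN1 : (1 : ℝ) ≤ N := by exact_mod_cast hN
  rw [hsum] at hlt
  simp only [Finset.sum_const, Finset.card_univ, Fintype.card_fin, nsmul_eq_mul] at hlt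
  have : (N : ℝ) * (1 / N) ^ 2 = 1 / N := by field_simp
  rw [this, lt_div_iff₀ (by linarith)] at hlt
  linarith

/-- A function with `Δ v ≥ κ v` on the unit ball around `x` is, at `x`, smaller than its upper
bound on the ball by a factor which decays exponentially in `√κ`. -/
theorem le_mul_of_mul_le_laplacian {N : ℕ} (hN : 0 < N) {U : Set (EuclideanSpace ℝ (Fin N))}
    (hU : IsOpen U) {v : EuclideanSpace ℝ (Fin N) → ℝ} (hv : ContDiffOn ℝ 2 v U)
    {x : EuclideanSpace ℝ (Fin N)} (hx : Metric.closedBall x 1 ⊆ U) {κ M : ℝ} (hκ : 0 < κ)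
    (hM : 0 ≤ M) (hvM : ∀ y ∈ Metric.closedBall x 1, v y ≤ M)
    (hΔ : ∀ y ∈ Metric.closedBall x 1, κ * v y ≤ Δ v y) :
    v x ≤ M * (N / (Real.cosh (Real.sqrt κ / N) + N - 1)) := by
  set k := Real.sqrt κ with hk
  have hk0 : 0 ≤ k := Real.sqrt_nonneg _
  have hkk : k * k = κ := Real.mul_self_sqrt hκ.le
  have hN1 : (1 : ℝ) ≤ N := by exact_mod_cast hN
  -- `Q` bounds the `cosh` sum below on the unit sphere: some coordinate is at least `1/N` in size,
  -- the other terms are at least `1`. Thus `W ≥ M` there, while `ΔW = κW`.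
  set Q := Real.cosh (k / N) + N - 1 with hQ
  have hQ0 : 0 < Q := by have := Real.one_le_cosh (k / N); linarith
  set A := M / Q with hA
  have hA0 : 0 ≤ A := by positivity
  set W : EuclideanSpace ℝ (Fin N) → ℝ := fun y => A * ∑ i, Real.cosh (k * (y i - x i)) with hW
  have hWc : Continuous W := by
    refine continuous_const.mul (continuous_finsetSum _ fun i _ => Real.continuous_cosh.comp ?_)
    fun_prop
  have hWx : W x = M * (N / Q) := by simp [hW, hA]; ring
  rw [← hWx]
  -- Otherwise `v - W` has a positive interior maximum, where `Δv ≤ ΔW = κW < κv`.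
  by_contra! hlt
  have hcont : ContinuousOn (fun y => v y - W y) (Metric.closedBall x 1) :=
    (hv.continuousOn.mono hx).sub hWc.continuousOn
  obtain ⟨y, hy, hmax⟩ := (isCompact_closedBall x 1).exists_isMaxOn
    ⟨x, Metric.mem_closedBall_self zero_le_one⟩ hcont
  have hypos : W y < v y := by
    have : v x - W x ≤ v y - W y := hmax (Metric.mem_closedBall_self zero_le_one)
    linarith
  have hyball : y ∈ Metric.ball x 1 := by
    rw [Metric.mem_ball]
    refine lt_of_le_of_ne hy fun h1 => ?_
    rw [dist_eq_norm] at h1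
    obtain ⟨i, hi⟩ := exists_abs_coord_ge h1
    have hc : Real.cosh (k / N) ≤ Real.cosh (k * (y i - x i)) := by
      rw [Real.cosh_le_cosh, abs_mul, abs_of_nonneg hk0, abs_of_nonneg (by positivity)]
      calc k / N = k * (1 / N) := by ring
        _ ≤ _ := mul_le_mul_of_nonneg_left hi hk0
    have hsum : Q ≤ ∑ i, Real.cosh (k * (y i - x i)) := by
      rw [← Finset.add_sum_erase _ _ (Finset.mem_univ i)]
      have h2 : ∑ j ∈ Finset.univ.erase i, (1 : ℝ) ≤
          ∑ j ∈ Finset.univ.erase i, Real.cosh (k * (y j - x j)) :=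
        Finset.sum_le_sum fun j _ => Real.one_le_cosh _
      simp only [Finset.sum_const, Finset.card_erase_of_mem (Finset.mem_univ i), Finset.card_univ,
        Fintype.card_fin, nsmul_eq_mul, mul_one, Nat.cast_sub hN, Nat.cast_one] at h2
      linarith
    have : M ≤ W y := by
      calc M = A * Q := by rw [hA]; field_simp
        _ ≤ W y := mul_le_mul_of_nonneg_left hsum hA0
    linarith [hvM y hy]
  have hloc : IsLocalMax (fun y => v y - W y) y :=
    hmax.isLocalMax (Filter.mem_of_superset (Metric.isOpen_ball.mem_nhds hyball)
      Metric.ball_subset_closedBall)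
  have hvy : ContDiffAt ℝ 2 v y := hv.contDiffAt (hU.mem_nhds (hx hy))
  have hdir : ∀ i, iteratedFDeriv ℝ 2 v y
      ![EuclideanSpace.basisFun (Fin N) ℝ i, EuclideanSpace.basisFun (Fin N) ℝ i] ≤
        A * (κ * Real.cosh (k * (y i - x i))) := by
    intro i
    set e := EuclideanSpace.basisFun (Fin N) ℝ i with he
    obtain ⟨hd1, hd2⟩ := deriv_deriv_comp_line (e := e) hvy
    have hWline : ∀ t : ℝ, W (y + t • e) =
        A * (Real.cosh (k * (t + (y i - x i))) +
          ∑ j ∈ Finset.univ.erase i, Real.cosh (k * (y j - x j))) := by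
      intro t
      simp only [hW]
      rw [← Finset.add_sum_erase _ _ (Finset.mem_univ i)]
      congr 2
      · simp [he]; ring_nf
      · refine Finset.sum_congr rfl fun j hj => ?_
        simp [he, (Finset.mem_erase.1 hj).1]
    have hw1 : ∀ t : ℝ, HasDerivAt (fun t : ℝ => W (y + t • e))
        (A * (Real.sinh (k * (t + (y i - x i))) * k)) t := by
      intro t
      simp only [hWline]
      have h0 : HasDerivAt (fun t : ℝ => k * (t + (y i - x i))) k t := by
        simpa using ((hasDerivAt_id t).add_const (y i - x i)).const_mul k
      exact ((h0.cosh).add_const _).const_mul A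
    have hw2 : HasDerivAt (fun t : ℝ => A * (Real.sinh (k * (t + (y i - x i))) * k))
        (A * (κ * Real.cosh (k * (y i - x i)))) 0 := by
      have h0 : HasDerivAt (fun t : ℝ => k * (t + (y i - x i))) k 0 := by
        simpa using ((hasDerivAt_id (0 : ℝ)).add_const (y i - x i)).const_mul k
      refine (((h0.sinh).mul_const k).const_mul A).congr_deriv ?_
      rw [← hkk, zero_add]; ring
    have heq : (deriv fun t : ℝ => v (y + t • e) - W (y + t • e)) =ᶠ[nhds 0]
        fun t => deriv (fun t : ℝ => v (y + t • e)) t -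
          A * (Real.sinh (k * (t + (y i - x i))) * k) := by
      filter_upwards [hd1] with t ht
      exact (ht.hasDerivAt.sub (hw1 t)).deriv
    have hcl : Filter.Tendsto (fun t : ℝ => y + t • e) (nhds 0) (nhds y) := by
      have : Continuous fun t : ℝ => y + t • e := by fun_prop
      simpa using this.tendsto 0
    have hloc' : IsLocalMax (fun t : ℝ => v (y + t • e) - W (y + t • e)) 0 := by
      have := hcl.eventually hloc
      simpa [IsLocalMax, IsMaxFilter] using this
    have hfin := hloc'.deriv_deriv_nonpos
      (hd1.self_of_nhds.continuousAt.sub (hw1 0).continuousAt)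
    rw [heq.deriv_eq, (hd2.fun_sub hw2).deriv] at hfin
    linarith
  have hΔy : Δ v y ≤ κ * W y := by
    rw [InnerProductSpace.laplacian_eq_iteratedFDeriv_orthonormalBasis v
      (EuclideanSpace.basisFun (Fin N) ℝ)]
    refine (Finset.sum_le_sum fun i _ => hdir i).trans_eq ?_
    simp only [hW, Finset.mul_sum]
    exact Finset.sum_congr rfl fun i _ => by ring
  have := hΔ y hy
  nlinarith [mul_lt_mul_of_pos_left hypos hκ]

/-! ### The decay rate -/

theorem exists_exp_le_cosh {N x₀ : ℝ} (hN : 1 ≤ N) (hx₀ : 0 < x₀) :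
    ∃ c > 0, ∀ X ≥ x₀, Real.exp (c * X) ≤ (Real.cosh X + N - 1) / N := by
  set q := (Real.cosh x₀ + N - 1) / N with hq
  have hq1 : 1 < q := by
    rw [hq, lt_div_iff₀ (by linarith)]
    linarith [Real.one_lt_cosh.2 hx₀.ne']
  set R := 2 * Real.log (2 * N) + 1 with hR
  have hR0 : 0 < R := by
    have := Real.log_nonneg (show (1 : ℝ) ≤ 2 * N by linarith)
    linarith
  have hlq := Real.log_pos hq1
  -- Up to `R` the right side is at least `q > 1`; beyond `R` it is at least `exp X / (2N) ≥ exp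
  -- (X/2)`.
  refine ⟨min (1 / 2) (Real.log q / R), by positivity, fun X hX => ?_⟩
  have hX0 : 0 < X := hx₀.trans_le hX
  rcases le_total X R with h | h
  · have h1 : min (1 / 2) (Real.log q / R) * X ≤ Real.log q := by
      calc _ ≤ Real.log q / R * R :=
            mul_le_mul (min_le_right _ _) h hX0.le (by positivity)
        _ = _ := by field_simp
    calc _ ≤ Real.exp (Real.log q) := Real.exp_le_exp.2 h1
      _ = q := Real.exp_log (by linarith)
      _ ≤ _ := by
        have : Real.cosh x₀ ≤ Real.cosh X := by
          rw [Real.cosh_le_cosh, abs_of_pos hx₀, abs_of_pos hX0]; exact hX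
        rw [hq]; gcongr
  · have h1 : min (1 / 2) (Real.log q / R) * X ≤ X - Real.log (2 * N) := by
      have := mul_le_mul_of_nonneg_right (min_le_left (1 / 2) (Real.log q / R)) hX0.le
      linarith
    calc _ ≤ Real.exp (X - Real.log (2 * N)) := Real.exp_le_exp.2 h1
      _ = Real.exp X / 2 / N := by
        rw [Real.exp_sub, Real.exp_log (by linarith)]; field_simp
      _ ≤ _ := by
        gcongr
        rw [Real.cosh_eq]
        have := Real.exp_pos (-X)
        linarith

/-- The rate `a` for which the decay of the barrier can be iterated. -/
theorem exists_rate {N : ℕ} (hN : 0 < N) {l b : ℝ} (hl : 0 < l) (hb : 0 < b) :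
    ∃ a > 0, a < b ∧ ∀ n : ℕ,
      Real.exp (-a * (n : ℝ) ^ 2) *
        (N / (Real.cosh (Real.sqrt (l + 2 * a * (n : ℝ) ^ 2) / N) + N - 1)) ≤
      Real.exp (-a * ((n + 1 : ℕ) : ℝ) ^ 2) := by
  have hN1 : (1 : ℝ) ≤ N := by exact_mod_cast hN
  have hsl := Real.sqrt_pos.2 hl
  obtain ⟨c, hc, hcosh⟩ := exists_exp_le_cosh hN1 (x₀ := Real.sqrt l / N) (by positivity)
  set d := c / N with hd
  have hd0 : 0 < d := by positivity
  set a := min (b / 2) (min (d ^ 2 / 4) (d * Real.sqrt l / 2)) with ha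
  have ha0 : 0 < a := by positivity
  have ha1 : a ≤ b / 2 := min_le_left _ _
  have ha2 : a ≤ d ^ 2 / 4 := (min_le_right _ _).trans (min_le_left _ _)
  have ha3 : a ≤ d * Real.sqrt l / 2 := (min_le_right _ _).trans (min_le_right _ _)
  clear_value a
  refine ⟨a, ha0, by linarith, fun n => ?_⟩
  set κ := l + 2 * a * (n : ℝ) ^ 2 with hκ
  have hκl : l ≤ κ := by have : 0 ≤ 2 * a * (n : ℝ) ^ 2 := by positivity
                         linarith
  have hQ := hcosh (Real.sqrt κ / N) (by gcongr)
  -- The exponent to gain is `a((n+1)² - n²)`. Squared, it is at most `8a²n² + 2a²`; `ha2` and `ha3`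
  -- absorb the two terms into `d²κ`.
  have hkey : a * (2 * n + 1) ≤ c * (Real.sqrt κ / N) := by
    have hrw : c * (Real.sqrt κ / N) = Real.sqrt (d ^ 2 * κ) := by
      rw [Real.sqrt_mul (by positivity), Real.sqrt_sq hd0.le, hd]; ring
    rw [hrw]
    refine Real.le_sqrt_of_sq_le ?_
    have e1 : a ^ 2 ≤ d ^ 2 * l / 4 := by
      calc a ^ 2 ≤ (d * Real.sqrt l / 2) ^ 2 := pow_le_pow_left₀ ha0.le ha3 2
        _ = d ^ 2 * (Real.sqrt l) ^ 2 / 4 := by ring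
        _ = _ := by rw [Real.sq_sqrt hl.le]
    have e2 : a ^ 2 * (n : ℝ) ^ 2 ≤ d ^ 2 / 4 * a * (n : ℝ) ^ 2 := by
      rw [pow_two a]; gcongr
    have e3 : (a * (2 * n + 1)) ^ 2 ≤ 8 * (a ^ 2 * (n : ℝ) ^ 2) + 2 * a ^ 2 := by
      nlinarith [sq_nonneg (a * (2 * n - 1))]
    have e4 : 0 ≤ d ^ 2 * l := by positivity
    rw [hκ]
    linarith
  have hQ0 : 0 < Real.cosh (Real.sqrt κ / N) + N - 1 := by
    linarith [Real.one_le_cosh (Real.sqrt κ / N)]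
  have h1 : (N : ℝ) / (Real.cosh (Real.sqrt κ / N) + N - 1) ≤ Real.exp (-(a * (2 * n + 1))) := by
    rw [Real.exp_neg, ← inv_div]
    exact inv_anti₀ (Real.exp_pos _) ((Real.exp_le_exp.2 hkey).trans hQ)
  calc _ ≤ Real.exp (-a * (n : ℝ) ^ 2) * Real.exp (-(a * (2 * n + 1))) := by gcongr
    _ = _ := by rw [← Real.exp_add]; push_cast; ring_nf

/-- Since `(n+1)² ≤ 2n² + 2`, halving the rate pays for the passage from `n` to `d`. -/
theorem exp_neg_mul_sq_le {a d : ℝ} (ha : 0 < a) {n : ℕ} (hd0 : 0 ≤ d) (hd : d ≤ n + 1) :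
    Real.exp (-a * (n : ℝ) ^ 2) ≤ Real.exp a * Real.exp (-(a / 2) * d ^ 2) := by
  rw [← Real.exp_add, Real.exp_le_exp]
  have : d ^ 2 ≤ (n + 1 : ℝ) ^ 2 := by gcongr
  nlinarith [sq_nonneg ((n : ℝ) - 1), mul_le_mul_of_nonneg_left this ha.le,
    mul_nonneg ha.le (sq_nonneg ((n : ℝ) - 1))]

/-! ### Laplacians of reflections and convolutions -/

theorem fderiv_comp_const_sub {E F : Type*} [NormedAddCommGroup E] [NormedSpace ℝ E]
    [NormedAddCommGroup F] [NormedSpace ℝ F] (f : E → F) (z y : E) :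
    fderiv ℝ (fun y => f (z - y)) y = -fderiv ℝ f (z - y) := by
  have h := (ContinuousLinearEquiv.neg ℝ (M := E)).comp_right_fderiv (f := fun w => f (z + w))
    (x := y)
  have h1 : (fun w => f (z + w)) ∘ (ContinuousLinearEquiv.neg ℝ (M := E)) =
      fun y => f (z - y) := by
    ext w; simp [sub_eq_add_neg]
  rw [h1, fderiv_comp_add_left] at h
  rw [h]
  ext w
  simp [sub_eq_add_neg]

theorem laplacian_comp_const_sub {E : Type*} [NormedAddCommGroup E] [InnerProductSpace ℝ E]
    [FiniteDimensional ℝ E] (f : E → ℝ) (z t : E) :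
    Δ (fun y => f (z - y)) t = Δ f (z - t) := by
  simp only [InnerProductSpace.laplacian_eq_iteratedFDeriv_stdOrthonormalBasis,
    iteratedFDeriv_two_apply]
  refine Finset.sum_congr rfl fun i _ => ?_
  rw [funext (fderiv_comp_const_sub f z), fderiv_fun_neg, fderiv_comp_const_sub]
  simp

theorem continuous_laplacian {E : Type*} [NormedAddCommGroup E] [InnerProductSpace ℝ E]
    [FiniteDimensional ℝ E] {f : E → ℝ} (hf : ContDiff ℝ 2 f) : Continuous (Δ f) := by
  rw [InnerProductSpace.laplacian_eq_iteratedFDeriv_stdOrthonormalBasis]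
  refine continuous_finsetSum _ fun i _ => ?_
  exact (ContinuousMultilinearMap.apply ℝ (fun _ : Fin 2 => E) ℝ _).continuous.comp
    (hf.continuous_iteratedFDeriv le_rfl)

theorem HasCompactSupport.laplacian {E : Type*} [NormedAddCommGroup E] [InnerProductSpace ℝ E]
    [FiniteDimensional ℝ E] {f : E → ℝ} (hf : HasCompactSupport f) :
    HasCompactSupport (Δ f) := by
  rw [InnerProductSpace.laplacian_eq_iteratedFDeriv_stdOrthonormalBasis]
  refine (hf.iteratedFDeriv (𝕜 := ℝ) 2).mono fun x hx h0 => hx ?_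
  simp [h0]

theorem laplacian_convolution {N : ℕ} {g ρ : EuclideanSpace ℝ (Fin N) → ℝ}
    (hg : LocallyIntegrable g) (hρ : ContDiff ℝ ∞ ρ) (hρc : HasCompactSupport ρ)
    (x : EuclideanSpace ℝ (Fin N)) :
    Δ (convolution g ρ (ContinuousLinearMap.lsmul ℝ ℝ) volume) x = ∫ t, g t * Δ ρ (x - t) := by
  have hderiv : ∀ (r : EuclideanSpace ℝ (Fin N) → ℝ), ContDiff ℝ ∞ r → HasCompactSupport r →
      ∀ e y, fderiv ℝ (convolution g r (ContinuousLinearMap.lsmul ℝ ℝ) volume) y e =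
        convolution g (fun a => fderiv ℝ r a e) (ContinuousLinearMap.lsmul ℝ ℝ) volume y := by
    intro r hr hrc e y
    have hr1 : ContDiff ℝ 1 r := hr.of_le (by exact_mod_cast le_top)
    rw [(hrc.hasFDerivAt_convolution_right _ hg hr1 y).fderiv]
    exact convolution_precompR_apply _ hg (hrc.fderiv ℝ) (hr1.continuous_fderiv one_ne_zero) y e
  have hJ : ContDiff ℝ ∞ (convolution g ρ (ContinuousLinearMap.lsmul ℝ ℝ) volume) :=
    hρc.contDiff_convolution_right _ hg hρ
  have hsm : ∀ (r : EuclideanSpace ℝ (Fin N) → ℝ), ContDiff ℝ ∞ r → ∀ e,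
      ContDiff ℝ ∞ (fun a => fderiv ℝ r a e) := fun r hr e =>
    (hr.fderiv_right (m := ∞) (by simp)).clm_apply contDiff_const
  have hcs : ∀ (r : EuclideanSpace ℝ (Fin N) → ℝ), HasCompactSupport r → ∀ e,
      HasCompactSupport (fun a => fderiv ℝ r a e) := fun r hr e => hr.fderiv_apply ℝ e
  have hsecond : ∀ (r : EuclideanSpace ℝ (Fin N) → ℝ), ContDiff ℝ ∞ r → ∀ e y,
      iteratedFDeriv ℝ 2 r y ![e, e] = fderiv ℝ (fun a => fderiv ℝ r a e) y e := by
    intro r hr e y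
    rw [iteratedFDeriv_two_apply, fderiv_clm_apply
      ((hr.fderiv_right (m := ∞) (by simp)).differentiable (by simp)).differentiableAt
      (differentiableAt_const e)]
    simp
  rw [InnerProductSpace.laplacian_eq_iteratedFDeriv_stdOrthonormalBasis,
    InnerProductSpace.laplacian_eq_iteratedFDeriv_stdOrthonormalBasis]
  simp only [Finset.mul_sum]
  rw [integral_finsetSum]
  · refine Finset.sum_congr rfl fun i _ => ?_
    set e := stdOrthonormalBasis ℝ (EuclideanSpace ℝ (Fin N)) i
    rw [hsecond _ hJ, funext (hderiv ρ hρ hρc e), hderiv _ (hsm ρ hρ e) (hcs ρ hρc e)]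
    simp only [convolution_def, ContinuousLinearMap.lsmul_apply, smul_eq_mul, hsecond ρ hρ]
  · intro i _
    set e := stdOrthonormalBasis ℝ (EuclideanSpace ℝ (Fin N)) i
    have := (hcs _ (hcs ρ hρc e) e).convolutionExists_right (ContinuousLinearMap.lsmul ℝ ℝ) hg
      (hsm _ (hsm ρ hρ e) e).continuous x
    simpa only [hsecond ρ hρ, ConvolutionExistsAt, ContinuousLinearMap.lsmul_apply,
      smul_eq_mul] using this

/-! ### Iteration over unit layers, classical and weak -/

theorem mul_log_sq_le {u M : ℝ} (hu : 0 < u) (huM : u ≤ M) :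
    u * Real.log (u ^ 2) ≤ 2 * Real.log M * u := by
  have := Real.log_le_log hu huM
  rw [Real.log_pow]
  push_cast
  nlinarith

theorem ball_subset_infDist {E : Type*} [PseudoMetricSpace E] {D : Set E} {x z : E} {n ε : ℝ}
    (h : n + dist z x + ε < Metric.infDist x D) {t : E} (ht : dist t z ≤ ε) :
    n < Metric.infDist t D := by
  have h1 := Metric.infDist_le_infDist_add_dist (s := D) (x := x) (y := t)
  have h2 := dist_triangle x z t
  rw [dist_comm x z, dist_comm z t] at h2
  linarith

theorem notMem_of_infDist_pos {E : Type*} [PseudoMetricSpace E] {D : Set E} {x : E} {n : ℝ}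
    (hn : 0 ≤ n) (h : n < Metric.infDist x D) : x ∈ Dᶜ := fun hx => by
  rw [Metric.infDist_zero_of_mem hx] at h
  linarith

theorem IsClassicalLogSubsolution.le_exp {N : ℕ} (hN : 0 < N)
    {D : Set (EuclideanSpace ℝ (Fin N))} (hD : IsClosed D) {l s a : ℝ} (hl : 0 < l) (hs : s ≤ 1)
    (ha : 0 < a) (hrate : ∀ n : ℕ, Real.exp (-a * (n : ℝ) ^ 2) *
        (N / (Real.cosh (Real.sqrt (l + 2 * a * (n : ℝ) ^ 2) / N) + N - 1)) ≤
      Real.exp (-a * ((n + 1 : ℕ) : ℝ) ^ 2))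
    {u : EuclideanSpace ℝ (Fin N) → ℝ} (hu : IsClassicalLogSubsolution D l s u) (n : ℕ) :
    ∀ x, (n : ℝ) < Metric.infDist x D → u x ≤ Real.exp (-a * (n : ℝ) ^ 2) := by
  induction n with
  | zero =>
    intro x hx
    simpa using (hu.le x (notMem_of_infDist_pos (Nat.cast_nonneg 0) hx)).trans hs
  | succ n ih =>
    intro x hx
    push_cast at hx
    have hball : ∀ y ∈ Metric.closedBall x 1, (n : ℝ) < Metric.infDist y D := fun y hy =>
      ball_subset_infDist (x := x) (z := x) (ε := 1) (by simpa using hx) hy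
    have hmem : ∀ y ∈ Metric.closedBall x 1, y ∈ Dᶜ := fun y hy =>
      notMem_of_infDist_pos n.cast_nonneg (hball y hy)
    refine (le_mul_of_mul_le_laplacian hN hD.isOpen_compl hu.contDiffOn hmem
      (by positivity) (Real.exp_pos _).le (fun y hy => ih y (hball y hy)) ?_).trans (hrate n)
    intro y hy
    have h1 := hu.ineq y (hmem y hy)
    have h2 := mul_log_sq_le (hu.pos y (hmem y hy)) (ih y (hball y hy))
    rw [Real.log_exp] at h2
    linarith

/-- Testing with the reflected mollifier `t ↦ r (z - t)`, supported where `u ≤ M`, turns the weak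
inequality into a pointwise linear one at `z`. -/
theorem IsWeakLogSubsolution.mollify {N : ℕ} {D : Set (EuclideanSpace ℝ (Fin N))}
    (hD : IsClosed D) {l s M : ℝ} (hs : s ≤ 1) {u : EuclideanSpace ℝ (Fin N) → ℝ}
    (hu : IsWeakLogSubsolution D l s u) {z : EuclideanSpace ℝ (Fin N)}
    (ρ : ContDiffBump (0 : EuclideanSpace ℝ (Fin N)))
    (hz : Metric.closedBall z ρ.rOut ⊆ Dᶜ)
    (huM : ∀ᵐ t, t ∈ Metric.closedBall z ρ.rOut → u t ≤ M) :
    LocallyIntegrable (Dᶜ.indicator u) ∧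
    convolution (Dᶜ.indicator u) (ρ.normed volume) (ContinuousLinearMap.lsmul ℝ ℝ) volume z ≤ M ∧
    (l - 2 * Real.log M) * convolution (Dᶜ.indicator u) (ρ.normed volume)
        (ContinuousLinearMap.lsmul ℝ ℝ) volume z ≤
      Δ (convolution (Dᶜ.indicator u) (ρ.normed volume)
        (ContinuousLinearMap.lsmul ℝ ℝ) volume) z := by
  have hDm : MeasurableSet Dᶜ := hD.isOpen_compl.measurableSet
  set r := ρ.normed volume with hr
  have hrs : ContDiff ℝ ∞ r := ρ.contDiff_normed
  have hrc : HasCompactSupport r := ρ.hasCompactSupport_normed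
  have hposD : ∀ᵐ t ∂volume.restrict Dᶜ, 0 < u t := (ae_restrict_iff' hDm).2 hu.pos
  have hleD : ∀ᵐ t ∂volume.restrict Dᶜ, u t ≤ 1 := by
    rw [ae_restrict_iff' hDm]
    filter_upwards [hu.le] with t ht htD using (ht htD).trans hs
  have hint : ∀ h : EuclideanSpace ℝ (Fin N) → ℝ, Continuous h → HasCompactSupport h →
      Integrable (fun t => u t * h t) (volume.restrict Dᶜ) := by
    intro h hc hcs
    refine ((hc.integrable_of_hasCompactSupport hcs).restrict).bdd_mul (c := 1)
      hu.aestronglyMeasurable ?_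
    filter_upwards [hposD, hleD] with t h0 h1
    rwa [Real.norm_eq_abs, abs_of_pos h0]
  have hgint : LocallyIntegrable (Dᶜ.indicator u) := by
    refine (locallyIntegrable_const (1 : ℝ)).mono
      ((aestronglyMeasurable_indicator_iff hDm).2 hu.aestronglyMeasurable) ?_
    filter_upwards [hu.pos, hu.le] with t h0 h1
    by_cases ht : t ∈ Dᶜ
    · rw [Set.indicator_of_mem ht, Real.norm_eq_abs, abs_of_pos (h0 ht)]
      simpa using (h1 ht).trans hs
    · rw [Set.indicator_of_notMem ht]; simp
  have hind : ∀ h : EuclideanSpace ℝ (Fin N) → ℝ,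
      ∫ t, Dᶜ.indicator u t * h t = ∫ t in Dᶜ, u t * h t := by
    intro h
    rw [← integral_indicator hDm]
    exact integral_congr_ae (.of_forall fun t => (Set.indicator_mul_left _ _ _).symm)
  have hsupp : ∀ t, t ∉ Metric.closedBall z ρ.rOut → r (z - t) = 0 := by
    intro t ht
    have : z - t ∉ Function.support r := by
      rw [hr, ρ.support_normed_eq, mem_ball_zero_iff, ← dist_eq_norm, dist_comm]
      exact fun h => ht h.le
    simpa using this
  set φ : EuclideanSpace ℝ (Fin N) → ℝ := fun t => r (z - t) with hφ
  have hφ0 : ∀ t, 0 ≤ φ t := fun t => ρ.nonneg_normed _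
  have hφs : ContDiff ℝ ∞ φ := hrs.comp (contDiff_const.sub contDiff_id)
  have hφt : tsupport φ ⊆ Metric.closedBall z ρ.rOut :=
    closure_minimal (fun t ht => by_contra fun h => ht (hsupp t h)) Metric.isClosed_closedBall
  have hφc : HasCompactSupport φ :=
    (isCompact_closedBall z ρ.rOut).of_isClosed_subset (isClosed_tsupport φ) hφt
  have hφi : Integrable φ := hφs.continuous.integrable_of_hasCompactSupport hφc
  have hφ1 : ∫ t, φ t = 1 := by
    rw [hφ, integral_sub_left_eq_self r volume z]
    exact ρ.integral_normed
  have hΔφ : ∀ t, Δ φ t = Δ r (z - t) := laplacian_comp_const_sub r z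
  have hJ : convolution (Dᶜ.indicator u) r (ContinuousLinearMap.lsmul ℝ ℝ) volume z =
      ∫ t in Dᶜ, u t * φ t := by
    rw [← hind]
    simp only [convolution_def, ContinuousLinearMap.lsmul_apply, smul_eq_mul, hφ]
  have hΔJ : Δ (convolution (Dᶜ.indicator u) r (ContinuousLinearMap.lsmul ℝ ℝ) volume) z =
      ∫ t in Dᶜ, u t * Δ φ t := by
    rw [laplacian_convolution hgint hrs hrc, ← hind]
    simp only [hΔφ]
  have hiφ := hint φ hφs.continuous hφc
  have hiΔ := hint (Δ φ) (continuous_laplacian (contDiff_infty.1 hφs 2))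
    hφc.laplacian
  refine ⟨hgint, ?_, ?_⟩
  · rw [hJ]
    have hφD : ∫ t in Dᶜ, φ t = 1 := by
      rw [setIntegral_eq_integral_of_forall_compl_eq_zero, hφ1]
      exact fun t ht => hsupp t fun h => ht (hz h)
    calc ∫ t in Dᶜ, u t * φ t ≤ ∫ t in Dᶜ, M * φ t := by
          refine integral_mono_ae hiφ (hφi.restrict.const_mul M) ?_
          filter_upwards [ae_restrict_of_ae huM] with t ht
          by_cases h : t ∈ Metric.closedBall z ρ.rOut
          · exact mul_le_mul_of_nonneg_right (ht h) (hφ0 t)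
          · simp [hφ, hsupp t h]
      _ = M := by rw [integral_const_mul, hφD, mul_one]
  · rw [hJ, hΔJ]
    have hlogm : AEStronglyMeasurable (fun t => u t * Real.log (u t ^ 2))
        (volume.restrict Dᶜ) := by
      have hm := hu.aestronglyMeasurable.aemeasurable
      exact (hm.mul (Real.measurable_log.comp_aemeasurable (hm.pow_const 2))).aestronglyMeasurable
    have hilog : Integrable (fun t => u t * Real.log (u t ^ 2) * φ t)
        (volume.restrict Dᶜ) := by
      -- `|u log u| < 1` for `0 < u ≤ 1`.
      refine hφi.restrict.bdd_mul (c := 2) hlogm ?_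
      filter_upwards [hposD, hleD] with t h0 h1
      have := (Real.abs_log_mul_self_lt (u t) h0 h1).le
      rw [Real.norm_eq_abs, Real.log_pow, show u t * (((2 : ℕ) : ℝ) * Real.log (u t)) =
        2 * (Real.log (u t) * u t) by push_cast; ring, abs_mul, abs_two]
      linarith
    have hineq := hu.ineq φ hφs hφc (hφt.trans hz) hφ0
    have hle : ∫ t in Dᶜ, u t * Real.log (u t ^ 2) * φ t ≤
        ∫ t in Dᶜ, 2 * Real.log M * (u t * φ t) := by
      refine integral_mono_ae hilog (hiφ.const_mul _) ?_
      filter_upwards [ae_restrict_of_ae huM, hposD] with t ht h0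
      by_cases h : t ∈ Metric.closedBall z ρ.rOut
      · have := mul_le_mul_of_nonneg_right (mul_log_sq_le h0 (ht h)) (hφ0 t)
        simpa [mul_assoc] using this
      · simp [hφ, hsupp t h]
    have hsplit : ∫ t in Dᶜ, (-(u t * Δ φ t) + l * u t * φ t) =
        -(∫ t in Dᶜ, u t * Δ φ t) + l * ∫ t in Dᶜ, u t * φ t := by
      simp only [mul_assoc l]
      rw [integral_add hiΔ.fun_neg (hiφ.const_mul l), integral_neg, integral_const_mul]
    rw [hsplit] at hineq
    rw [integral_const_mul] at hle
    linarith

theorem IsWeakLogSubsolution.le_exp {N : ℕ} (hN : 0 < N)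
    {D : Set (EuclideanSpace ℝ (Fin N))} (hD : IsClosed D) {l s a : ℝ} (hl : 0 < l) (hs : s ≤ 1)
    (ha : 0 < a) (hrate : ∀ n : ℕ, Real.exp (-a * (n : ℝ) ^ 2) *
        (N / (Real.cosh (Real.sqrt (l + 2 * a * (n : ℝ) ^ 2) / N) + N - 1)) ≤
      Real.exp (-a * ((n + 1 : ℕ) : ℝ) ^ 2))
    {u : EuclideanSpace ℝ (Fin N) → ℝ} (hu : IsWeakLogSubsolution D l s u) (n : ℕ) :
    ∀ᵐ x, (n : ℝ) < Metric.infDist x D → u x ≤ Real.exp (-a * (n : ℝ) ^ 2) := by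
  induction n with
  | zero =>
    filter_upwards [hu.le] with x hx hd
    simpa using (hx (notMem_of_infDist_pos (Nat.cast_nonneg 0) hd)).trans hs
  | succ n ih =>
    by_cases hne : ∃ x, ((n + 1 : ℕ) : ℝ) < Metric.infDist x D
    swap
    · push Not at hne
      exact .of_forall fun x hx => absurd hx (hne x).not_gt
    set ρ : ℕ → ContDiffBump (0 : EuclideanSpace ℝ (Fin N)) := fun k =>
      ⟨1 / (2 * ((k : ℝ) + 1)), 1 / ((k : ℝ) + 1), by positivity, by
        apply one_div_lt_one_div_of_lt <;> nlinarith [(Nat.cast_nonneg k : (0 : ℝ) ≤ k)]⟩ with hρ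
    have hρlim : Filter.Tendsto (fun k => (ρ k).rOut) Filter.atTop (nhds 0) :=
      tendsto_one_div_add_atTop_nhds_zero_nat
    have hmoll : ∀ x z k, (n : ℝ) + dist z x + (ρ k).rOut < Metric.infDist x D →
        _ := fun x z k h => hu.mollify hD hs (M := Real.exp (-a * (n : ℝ) ^ 2)) (z := z) (ρ k)
      (fun t ht => notMem_of_infDist_pos n.cast_nonneg (ball_subset_infDist h ht))
      (by filter_upwards [ih] with t ht htb using ht (ball_subset_infDist h htb))
    -- The strict inequality leaves room for small mollification radii, uniformly on the unit ball.
    have hev : ∀ x, ((n + 1 : ℕ) : ℝ) < Metric.infDist x D →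
        ∀ᶠ k in Filter.atTop, ∀ z ∈ Metric.closedBall x 1,
          (n : ℝ) + dist z x + (ρ k).rOut < Metric.infDist x D := by
      intro x hx
      push_cast at hx
      filter_upwards [hρlim.eventually_lt_const (sub_pos.2 hx)] with k hk z hz
      have : dist z x ≤ 1 := hz
      linarith
    have hg : LocallyIntegrable (Dᶜ.indicator u) := by
      obtain ⟨x, hx⟩ := hne
      obtain ⟨k, hk⟩ := (hev x hx).exists
      exact (hmoll x x k (hk x (Metric.mem_closedBall_self zero_le_one))).1
    filter_upwards [ContDiffBump.ae_convolution_tendsto_right_of_locallyIntegrable (φ := ρ)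
      (K := 2) hρlim (.of_forall fun k => le_of_eq (by simp only [hρ]; field_simp)) hg]
      with x hlim hx
    have hxD : x ∈ Dᶜ := notMem_of_infDist_pos (Nat.cast_nonneg _) hx
    rw [Set.indicator_of_mem hxD] at hlim
    refine le_of_tendsto hlim ?_
    filter_upwards [hev x hx] with k hk
    have hswap : convolution ((ρ k).normed volume) (Dᶜ.indicator u)
        (ContinuousLinearMap.lsmul ℝ ℝ) volume x =
        convolution (Dᶜ.indicator u) ((ρ k).normed volume)
          (ContinuousLinearMap.lsmul ℝ ℝ) volume x := by
      rw [convolution_eq_swap, convolution_def]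
      simp [mul_comm]
    rw [hswap]
    have hcd : ContDiff ℝ ∞ (convolution (Dᶜ.indicator u) ((ρ k).normed volume)
        (ContinuousLinearMap.lsmul ℝ ℝ) volume) :=
      (ρ k).hasCompactSupport_normed.contDiff_convolution_right _ hg (ρ k).contDiff_normed
    refine (le_mul_of_mul_le_laplacian hN isOpen_univ
      (contDiff_infty.1 hcd 2).contDiffOn (Set.subset_univ _)
      (by positivity) (Real.exp_pos _).le (fun z hz => (hmoll x z k (hk z hz)).2.1) ?_).trans
      (hrate n)
    intro z hz
    have := (hmoll x z k (hk z hz)).2.2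
    rw [Real.log_exp] at this
    convert this using 2
    ring

/-! ### Conclusion -/

theorem mainTheorem5 (N : ℕ) (l s b : ℝ) (hl : 0 < l) (hs : s ∈ Set.Ioo (0 : ℝ) 1)
    (hb : b ∈ Set.Ioo 0 (Real.sqrt l)) :
    ∃ a ∈ Set.Ioo 0 b, ∃ C : ℝ, 0 < C ∧
      ∀ D : Set (EuclideanSpace ℝ (Fin N)), D.Nonempty → IsClosed D → Convex ℝ D →
        ∀ u : EuclideanSpace ℝ (Fin N) → ℝ,
          (IsClassicalLogSubsolution D l s u →
            ∀ x ∈ Dᶜ, u x ≤ C * Real.exp (-a * Metric.infDist x D ^ 2)) ∧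
          (IsWeakLogSubsolution D l s u →
            ∀ᵐ x, x ∈ Dᶜ → u x ≤ C * Real.exp (-a * Metric.infDist x D ^ 2)) := by
  rcases Nat.eq_zero_or_pos N with rfl | hN
  · refine ⟨b / 2, ⟨half_pos hb.1, half_lt_self hb.1⟩, 1, one_pos, fun D hne _ _ u => ?_⟩
    have hmem : ∀ x, x ∈ D := fun x => by
      obtain ⟨y, hy⟩ := hne
      rwa [Subsingleton.elim x y]
    exact ⟨fun _ x hx => absurd (hmem x) hx, fun _ => .of_forall fun x hx => absurd (hmem x) hx⟩
  obtain ⟨a, ha, hab, hrate⟩ := exists_rate hN hl hb.1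
  refine ⟨a / 2, ⟨half_pos ha, by linarith⟩, Real.exp a, Real.exp_pos a,
    fun D hne hD _ u => ?_⟩
  -- `n` is the ceiling minus one rather than the floor: the layer bound needs distance strictly
  -- above `n`.
  have hn : ∀ x ∈ Dᶜ, ∃ n : ℕ, (n : ℝ) < Metric.infDist x D ∧ Metric.infDist x D ≤ n + 1 := by
    intro x hx
    have hpos := (hD.notMem_iff_infDist_pos hne).1 hx
    obtain ⟨n, hn⟩ := Nat.exists_eq_succ_of_ne_zero (Nat.ceil_pos.2 hpos).ne'
    refine ⟨n, Nat.lt_ceil.1 (by omega), ?_⟩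
    have := Nat.le_ceil (Metric.infDist x D)
    rw [hn] at this
    exact_mod_cast this
  constructor
  · intro hu x hx
    obtain ⟨n, h1, h2⟩ := hn x hx
    exact (hu.le_exp hN hD hl hs.2.le ha hrate n x h1).trans
      (exp_neg_mul_sq_le ha Metric.infDist_nonneg h2)
  · intro hu
    filter_upwards [ae_all_iff.2 fun n => hu.le_exp hN hD hl hs.2.le ha hrate n] with x hx hxD
    obtain ⟨n, h1, h2⟩ := hn x hxD
    exact (hx n h1).trans (exp_neg_mul_sq_le ha Metric.infDist_nonneg h2)
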